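/- Let $\overline{\mathbb R} = (\mathbb R \cup \{\infty\}, \min, +)$ be the tropical semiring, let $n \ge 1$, and let $S_n$ be either the polynomial semiring $\overline{\mathbb R}[x_1,\dots,x_n]$ or the Laurent polynomial semiring $\overline{\mathbb R}[x_1^{\pm 1},\dots,x_n^{\pm 1}]$. Write $[f]_{\mathbf x^{\mathbf u}}$ for the coefficient of $\mathbf x^{\mathbf u}$ in $f$. An ideal $I \subseteq S_n$ is *tropical* if for all $f,g \in I$ and every monomial $\mathbf x^{\mathbf u}$ with $[f]_{\mathbf x^{\mathbf u}} = [g]_{\mathbf x^{\mathbf u}} \ne \infty$ there is $h \in I$ with $[h]_{\mathbf x^{\mathbf u}} = \infty$ and $[h]_{\mathbf x^{\mathbf v}} \ge \min([f]_{\mathbf x^{\mathbf v}}, [g]_{\mathbf x^{\mathbf v}})$ for all monomials $\mathbf x^{\mathbf v}$, with equality whenever $[f]_{\mathbf x^{\mathbf v}} \ne [g]_{\mathbf x^{\mathbf v}}$. For a homogeneous ideal $J \subseteq \overline{\mathbb R}[x_0,\dots,x_n]$, the Hilbert function $H_J(d)$ is the maximal size of a set $B$ of monomials of degree $d$ that does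 not contain the support of any nonzero polynomial in $J$ (the zero polynomial being the one all of whose coefficients are $\infty$). If $H_J(d)$ agrees with a polynomial in $d$ for all large $d$ (the Hilbert polynomial of $J$), then $\dim(J)$ is the degree of that polynomial, where the zero polynomial has degree $-1$. For an ideal $I \subseteq \overline{\mathbb R}[x_1,\dots,x_n]$ put $\dim(I) = \dim(I^h)$, where $I^h \subseteq \overline{\mathbb R}[x_0,\dots,x_n]$ is the ideal generated by the homogenizations of the elements of $I$ with respect to $x_0$; for an ideal $I \subseteq \overline{\mathbb R}[x_1^{\pm 1},\dots,x_n^{\pm 1}]$ put $\dim(I) = \dim(I \cap \overline{\mathbb R}[x_1,\dots,x_n])$. For $a \in \mathbb R$ let $I|_{x_n=a} = \{ f(x_1,\dots,x_{n-1},a) : f \in I \}$, an ideal of $S_{n-1}$. **Proposition.** Let $I \subsetneq S_n$ be a proper tropical ideal and let $a \in \mathbb R$. Then the dimensions of $I$ and of $I|_{x_n=a}$ are well-defined (the Hilbert polynomials exist), and $$\dim(I|_{x_n=a}) \le \dim(I) - 1.$$ -/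

import Mathlib

namespace TropIdeal

open Filter

/-- The tropical semiring `ℝ ∪ {∞}`: addition is `min`, multiplication is `+`.  Its zero element
is `∞` and its unit element is the real number `0`. -/
abbrev T : Type := Tropical (WithTop ℝ)

/-- A real number as an element of the tropical semiring. -/
def ofReal (a : ℝ) : T := Tropical.trop (a : WithTop ℝ)

/-- The tropical polynomial semiring in `n` variables. -/
abbrev Poly (n : ℕ) : Type := MvPolynomial (Fin n) T

/-- The tropical Laurent polynomial semiring in `n` variables: its monomials are indexed by
the exponent vectors in `ℤ ^ n`. -/
abbrev Laurent (n : ℕ) : Type := AddMonoidAlgebra T (Fin n → ℤ)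

/-- `h` is an elimination of the monomial `u` from `f` and `g`; here `f`, `g`, `h` are given by
their coefficients, and the order is the usual order of `ℝ ∪ {∞}`. -/
def IsElimination {M : Type*} (u : M) (f g h : M → T) : Prop :=
  h u = 0 ∧ ∀ v, min (f v) (g v) ≤ h v ∧ (f v ≠ g v → h v = min (f v) (g v))

/-- An ideal of the polynomial semiring is tropical if it satisfies monomial elimination. -/
def IsTropicalPoly {n : ℕ} (I : Ideal (Poly n)) : Prop :=
  ∀ f ∈ I, ∀ g ∈ I, ∀ u : Fin n →₀ ℕ, f.coeff u = g.coeff u → f.coeff u ≠ 0 →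
    ∃ h ∈ I, IsElimination u (fun v => f.coeff v) (fun v => g.coeff v) (fun v => h.coeff v)

/-- An ideal of the Laurent polynomial semiring is tropical if it satisfies monomial
elimination. -/
def IsTropicalLaurent {n : ℕ} (I : Ideal (Laurent n)) : Prop :=
  ∀ f ∈ I, ∀ g ∈ I, ∀ u : Fin n → ℤ, f.coeff u = g.coeff u → f.coeff u ≠ 0 →
    ∃ h ∈ I, IsElimination u (fun v => f.coeff v) (fun v => g.coeff v) (fun v => h.coeff v)

/-! ### Specialization of the last variable -/

/-- The substitution `f ↦ f(x₁, …, xₙ, a)` for polynomials. -/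
noncomputable def substPoly {n : ℕ} (a : ℝ) : Poly (n + 1) →+* Poly n :=
  MvPolynomial.eval₂Hom MvPolynomial.C
    (Fin.lastCases (MvPolynomial.C (ofReal a)) (fun i : Fin n => MvPolynomial.X i))

/-- The substitution `f ↦ f(x₁, …, xₙ, a)` on Laurent monomials: the monomial with exponent
vector `u` is sent to the one with exponent vector `(u₁, …, uₙ)`, with coefficient the tropical
power `a ^ uₙ₊₁`, which is the real number `uₙ₊₁ * a`. -/
noncomputable def substMonomial {n : ℕ} (a : ℝ) :
    Multiplicative (Fin (n + 1) → ℤ) →* Laurent n where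
  toFun u := AddMonoidAlgebra.single (Fin.init (Multiplicative.toAdd u))
    (ofReal ((Multiplicative.toAdd u (Fin.last n) : ℝ) * a))
  map_one' := by
    rw [AddMonoidAlgebra.one_def]
    congr 1
    simp [ofReal]
  map_mul' u v := by
    rw [AddMonoidAlgebra.single_mul_single]
    congr 1
    simp only [toAdd_mul, Pi.add_apply, Int.cast_add, add_mul, ofReal]
    rfl

/-- The substitution `f ↦ f(x₁, …, xₙ, a)` for Laurent polynomials. -/
noncomputable def substLaurent {n : ℕ} (a : ℝ) : Laurent (n + 1) →+* Laurent n :=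
  (AddMonoidAlgebra.lift T (Laurent n) (Fin (n + 1) → ℤ) (substMonomial a)).toRingHom

theorem substPoly_rename {n : ℕ} (a : ℝ) (f : Poly n) :
    substPoly a (MvPolynomial.rename Fin.castSucc f) = f := by
  simp only [substPoly, MvPolynomial.coe_eval₂Hom, MvPolynomial.eval₂_rename]
  have : (Fin.lastCases (MvPolynomial.C (ofReal a)) (fun i : Fin n => MvPolynomial.X i) :
      Fin (n + 1) → Poly n) ∘ Fin.castSucc = MvPolynomial.X := by
    funext i; simp
  rw [this, MvPolynomial.eval₂_eta]

theorem substLaurent_single {n : ℕ} (a : ℝ) (u : Fin (n + 1) → ℤ) (c : T) :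
    substLaurent a (AddMonoidAlgebra.single u c) =
      AddMonoidAlgebra.single (Fin.init u) (c * ofReal ((u (Fin.last n) : ℝ) * a)) := by
  simp [substLaurent, substMonomial, AddMonoidAlgebra.lift_single]

theorem substPoly_surjective {n : ℕ} (a : ℝ) :
    Function.Surjective (substPoly (n := n) a) :=
  fun f => ⟨_, substPoly_rename a f⟩

theorem substLaurent_surjective {n : ℕ} (a : ℝ) :
    Function.Surjective (substLaurent (n := n) a) := by
  intro f
  induction f using AddMonoidAlgebra.induction_linear with
  | zero => exact ⟨0, map_zero _⟩
  | add f g hf hg =>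
    obtain ⟨F, rfl⟩ := hf
    obtain ⟨G, rfl⟩ := hg
    exact ⟨F + G, map_add _ _ _⟩
  | single u c =>
    refine ⟨AddMonoidAlgebra.single (Fin.snoc (α := fun _ => ℤ) u 0) c, ?_⟩
    rw [substLaurent_single, Fin.init_snoc, Fin.snoc_last]
    congr 1
    simp [ofReal]

/-- The image of an ideal under a surjective homomorphism of semirings, as an ideal. -/
def imageIdeal {R S : Type*} [CommSemiring R] [CommSemiring S] (φ : R →+* S)
    (hφ : Function.Surjective φ) (I : Ideal R) : Ideal S where
  carrier := φ '' I
  zero_mem' := ⟨0, I.zero_mem, map_zero φ⟩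
  add_mem' := by
    rintro _ _ ⟨f, hf, rfl⟩ ⟨g, hg, rfl⟩
    exact ⟨f + g, I.add_mem hf hg, map_add φ f g⟩
  smul_mem' := by
    rintro c _ ⟨f, hf, rfl⟩
    obtain ⟨b, rfl⟩ := hφ c
    exact ⟨b * f, I.mul_mem_left b hf, map_mul φ b f⟩

/-- The specialization `I|_{x = a} = { f(x₁, …, xₙ, a) : f ∈ I }` at the last variable `x`. -/
noncomputable def specializePoly {n : ℕ} (a : ℝ) (I : Ideal (Poly (n + 1))) : Ideal (Poly n) :=
  imageIdeal (substPoly a) (substPoly_surjective a) I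

/-- The specialization `I|_{x = a} = { f(x₁, …, xₙ, a) : f ∈ I }` at the last variable `x`. -/
noncomputable def specializeLaurent {n : ℕ} (a : ℝ) (I : Ideal (Laurent (n + 1))) :
    Ideal (Laurent n) :=
  imageIdeal (substLaurent a) (substLaurent_surjective a) I

/-! ### Hilbert function and dimension -/

/-- The homogenization of a tropical polynomial; the new variable `x₀` has index `0`. -/
noncomputable def homogenize {n : ℕ} (f : Poly n) : Poly (n + 1) :=
  ∑ u ∈ f.support,
    MvPolynomial.monomial (Finsupp.cons (f.totalDegree - u.degree) u) (f.coeff u)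

/-- The homogenization of an ideal: the ideal generated by the homogenizations of its
elements. -/
noncomputable def homogenizeIdeal {n : ℕ} (I : Ideal (Poly n)) : Ideal (Poly (n + 1)) :=
  Ideal.span (homogenize '' I)

/-- The finite set `B` of monomials does not contain the support of a (nonzero) element of `J`. -/
def IsIndependent {n : ℕ} (J : Ideal (Poly n)) (B : Finset (Fin n →₀ ℕ)) : Prop :=
  ∀ f ∈ J, f.support ⊆ B → f = 0

open Classical in
/-- The Hilbert function of an ideal `J` (used for homogeneous ideals): the rank of the matroid of
`J` on the finite set of all monomials of degree `d`, i.e. the maximal size of an independent set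
of monomials of degree `d`. -/
noncomputable def hilbertFunction {n : ℕ} (J : Ideal (Poly n)) (d : ℕ) : ℕ :=
  (((Finset.univ : Finset (Fin n)).finsuppAntidiag d).powerset.filter (IsIndependent J)).sup
    Finset.card

/-- The Hilbert function of `J` agrees with the polynomial `p` in all large degrees. -/
def IsHilbertPolynomial {n : ℕ} (J : Ideal (Poly n)) (p : Polynomial ℚ) : Prop :=
  ∀ᶠ d : ℕ in atTop, (hilbertFunction J d : ℚ) = p.eval (d : ℚ)

theorem IsHilbertPolynomial.unique {n : ℕ} {J : Ideal (Poly n)} {p q : Polynomial ℚ}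
    (hp : IsHilbertPolynomial J p) (hq : IsHilbertPolynomial J q) : p = q := by
  obtain ⟨N, hN⟩ := eventually_atTop.1 (hp.and hq)
  refine Polynomial.eq_of_infinite_eval_eq p q
    (((Set.Ici_infinite N).image (Nat.cast_injective (R := ℚ)).injOn).mono ?_)
  rintro _ ⟨d, hd, rfl⟩
  exact (hN d hd).1.symm.trans (hN d hd).2

/-- The Hilbert polynomial (it is unique if it exists). -/
noncomputable def hilbertPolynomial {n : ℕ} (J : Ideal (Poly n)) : Polynomial ℚ :=
  open Classical in if h : ∃ p, IsHilbertPolynomial J p then h.choose else 0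

/-- The dimension of a homogeneous ideal: the degree of its Hilbert polynomial, where the zero
polynomial has degree `-1`. -/
noncomputable def dimHomogeneous {n : ℕ} (J : Ideal (Poly n)) : ℤ :=
  open Classical in
  if hilbertPolynomial J = 0 then -1 else ((hilbertPolynomial J).natDegree : ℤ)

/-- The homogenization of `I` has a Hilbert polynomial, so that the dimension of `I` is
well-defined. -/
def HasDimPoly {n : ℕ} (I : Ideal (Poly n)) : Prop :=
  ∃ p, IsHilbertPolynomial (homogenizeIdeal I) p

/-- The dimension of an ideal of the polynomial semiring. -/
noncomputable def dimPoly {n : ℕ} (I : Ideal (Poly n)) : ℤ :=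
  dimHomogeneous (homogenizeIdeal I)

/-- The inclusion of the polynomial semiring in the Laurent polynomial semiring. -/
noncomputable def toLaurent (n : ℕ) : Poly n →+* Laurent n :=
  (MvPolynomial.aeval
    (fun i : Fin n => (AddMonoidAlgebra.single (Pi.single i 1) 1 : Laurent n))).toRingHom

/-- The intersection of an ideal of the Laurent polynomial semiring with the polynomial
semiring. -/
noncomputable def affinePart {n : ℕ} (I : Ideal (Laurent n)) : Ideal (Poly n) :=
  I.comap (toLaurent n)

/-- The dimension of an ideal of the Laurent polynomial semiring is well-defined. -/
def HasDimLaurent {n : ℕ} (I : Ideal (Laurent n)) : Prop := HasDimPoly (affinePart I)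

/-- The dimension of an ideal of the Laurent polynomial semiring. -/
noncomputable def dimLaurent {n : ℕ} (I : Ideal (Laurent n)) : ℤ := dimPoly (affinePart I)

end TropIdeal

/-!
Only the supports of the members of an ideal matter.  Since there is no cancellation in the tropical
semiring, the supports of the members of `I` form a family of finite sets of monomials that is
stable under translation, and specializing the last variable projects each of these sets by
forgetting the last exponent, whatever the value `a` is.  Monomial elimination becomes the vector
elimination axiom of matroids (`HasElimination`), and the Hilbert function of the homogenization of
`I` at `d` is the rank of the set of monomials of degree at most `d`
(`hilbertFunction_homogenizeIdeal`).

*Hilbert polynomials.* By Steinitz exchange (`Indep.card_le_of_spanned`) the rank of a finite set is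
the number of its non-leading elements, for any linear order of the monomials
(`rank_eq_card_not_isLead`).  For the graded lexicographic order the leading monomials form a
monomial ideal, and the number of monomials of degree at most `d` outside of a monomial ideal is
eventually polynomial (`eventuallyPoly_card_degreeBall_filter`).

*The specialization.* The projected family again has elimination, although the projections of sets
need not be eliminated by projecting a single elimination: one considers many translates of the two
given sets in the direction of the last variable and counts leading elements
(`HasElimination.image_fst`).  Hence the specialization has a Hilbert polynomial, too.

*The inequality.* The preimage of an independent set under the projection is independent.  Each
monomial of degree at most `d` has at least `d + 1` preimages of degree at most `2 * d`.  So the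
Hilbert functions of `I` and of its specialization `J` satisfy `(d + 1) * H_J d ≤ H_I (2 * d)`
(`mul_rank_le_rank`), and the degree drops by at least one; if `H_J` vanishes eventually, then
`dim J = -1`, whereas `dim I ≥ 0` because `I` is proper.

*Laurent polynomials.* The polynomial part of the specialization and the specialization of the
polynomial part have the same supports (`supports_affinePart_specializeLaurent`), so the Laurent case
reduces to the polynomial case.
-/

namespace TropIdeal

open Filter

/-! ### Exchange and rank for set families with elimination -/

section Families

variable {M : Type*}

/-- Vector elimination for a family of finite sets, the combinatorial shadow of the monomial
elimination axiom: if `u` is common to `A` and `B`, it can be removed from `A ∪ B` while keeping a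
prescribed element `w` of `A \ B`.  Families with this property play the role of the
unions of circuits of a matroid. -/
def HasElimination (𝓕 : Set (Finset M)) : Prop :=
  ∀ A ∈ 𝓕, ∀ B ∈ 𝓕, ∀ u ∈ A, u ∈ B → ∀ w ∈ A, w ∉ B →
    ∃ C ∈ 𝓕, u ∉ C ∧ w ∈ C ∧ ∀ x ∈ C, x ∈ A ∨ x ∈ B

/-- A set is independent for `𝓕` if it contains no nonempty member of `𝓕`. -/
def Indep (𝓕 : Set (Finset M)) (B : Finset M) : Prop :=
  ∀ A ∈ 𝓕, A ⊆ B → A = ∅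

open Classical in
/-- The largest size of an independent subset of `E`. -/
noncomputable def rank (𝓕 : Set (Finset M)) (E : Finset M) : ℕ :=
  (E.powerset.filter (Indep 𝓕)).sup Finset.card

theorem Indep.card_le_rank {𝓕 : Set (Finset M)} {B E : Finset M} (hB : Indep 𝓕 B)
    (hBE : B ⊆ E) : B.card ≤ rank 𝓕 E := by
  classical
  exact Finset.le_sup (f := Finset.card) (by simpa using ⟨hBE, hB⟩)

theorem rank_le {𝓕 : Set (Finset M)} {E : Finset M} {k : ℕ}
    (h : ∀ B ⊆ E, Indep 𝓕 B → B.card ≤ k) : rank 𝓕 E ≤ k := by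
  classical
  refine Finset.sup_le fun B hB => ?_
  simp only [Finset.mem_filter, Finset.mem_powerset] at hB
  exact h B hB.1 hB.2

theorem indep_empty (𝓕 : Set (Finset M)) : Indep 𝓕 ∅ :=
  fun _ _ h => Finset.subset_empty.1 h

theorem exists_indep_card_eq_rank (𝓕 : Set (Finset M)) (E : Finset M) :
    ∃ B ⊆ E, Indep 𝓕 B ∧ B.card = rank 𝓕 E := by
  classical
  have hne : (E.powerset.filter (Indep 𝓕)).Nonempty := ⟨∅, by simpa using indep_empty 𝓕⟩
  obtain ⟨B, hB, h⟩ := Finset.exists_mem_eq_sup _ hne Finset.card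
  simp only [Finset.mem_filter, Finset.mem_powerset] at hB
  exact ⟨B, hB.1, hB.2, h.symm⟩

/-- Steinitz exchange: an independent set is no larger than a set that spans it. -/
theorem Indep.card_le_of_spanned {𝓕 : Set (Finset M)} (h𝓕 : HasElimination 𝓕) {W T : Finset M}
    (hW : Indep 𝓕 W) (hT : ∀ w ∈ W, w ∉ T → ∃ A ∈ 𝓕, w ∈ A ∧ ∀ x ∈ A, x ≠ w → x ∈ T) :
    W.card ≤ T.card := by
  classical
  induction hk : (W \ T).card generalizing T with
  | zero =>
    exact Finset.card_le_card (Finset.sdiff_eq_empty_iff_subset.1 (Finset.card_eq_zero.1 hk))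
  | succ k ih =>
    obtain ⟨w, hw⟩ : (W \ T).Nonempty := Finset.card_pos.1 (by omega)
    obtain ⟨hwW, hwT⟩ := Finset.mem_sdiff.1 hw
    obtain ⟨A, hA, hwA, hAT⟩ := hT w hwW hwT
    -- `A` is not contained in `W`, so some `t ∈ T \ W` can be traded for `w`
    obtain ⟨t, htA, htW⟩ : ∃ t ∈ A, t ∉ W := by
      by_contra! h
      have := hW A hA h
      simp [this] at hwA
    have htw : t ≠ w := fun h => htW (h ▸ hwW)
    have htT : t ∈ T := hAT t htA htw
    have hcard : (insert w (T.erase t)).card = T.card := by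
      rw [Finset.card_insert_of_notMem (fun h => hwT (Finset.mem_of_mem_erase h)),
        Finset.card_erase_of_mem htT]
      have := Finset.card_pos.2 ⟨t, htT⟩
      omega
    rw [← hcard]
    refine ih (fun w' hw' hw'T => ?_) ?_
    · have hw'w : w' ≠ w := fun h => hw'T (by simp [h])
      have hw't : w' ≠ t := fun h => htW (h ▸ hw')
      have hw'T' : w' ∉ T := fun h => hw'T (by simp [hw't, h])
      obtain ⟨A', hA', hwA', hAT'⟩ := hT w' hw' hw'T'
      by_cases htA' : t ∈ A'
      · obtain ⟨C, hC, htC, hw'C, hCs⟩ := h𝓕 A' hA' A hA t htA' htA w' hwA'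
          (fun h => hw'T' (hAT _ h hw'w))
        refine ⟨C, hC, hw'C, fun x hx hxw' => ?_⟩
        have hxt : x ≠ t := fun h => htC (h ▸ hx)
        by_cases hxw : x = w
        · simp [hxw]
        · rcases hCs x hx with h | h
          · simp [hxt, hAT' x h hxw']
          · simp [hxt, hAT x h hxw]
      · refine ⟨A', hA', hwA', fun x hx hxw' => ?_⟩
        have hxt : x ≠ t := fun h => htA' (h ▸ hx)
        simp [hxt, hAT' x hx hxw']
    · have : W \ insert w (T.erase t) = (W \ T).erase w := by
        ext x
        simp only [Finset.mem_sdiff, Finset.mem_insert, Finset.mem_erase, not_or, not_and]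
        constructor
        · rintro ⟨h1, h2, h3⟩
          exact ⟨h2, h1, h3 fun h => htW (h ▸ h1)⟩
        · rintro ⟨h1, h2, h3⟩
          exact ⟨h2, h1, fun _ => h3⟩
      rw [this, Finset.card_erase_of_mem hw, hk]
      rfl

/-- Transitivity of spanning: if `u` is spanned by `A \ {u}` and every further element of `A` is
spanned by `T`, then `u` is spanned by `T`. -/
theorem HasElimination.exists_spanned {𝓕 : Set (Finset M)} (h𝓕 : HasElimination 𝓕) {T : Set M}
    {u : M} (huT : u ∉ T) {A : Finset M} (hA : A ∈ 𝓕) (huA : u ∈ A)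
    (hT : ∀ v ∈ A, v ≠ u → v ∉ T → ∃ B ∈ 𝓕, v ∈ B ∧ ∀ x ∈ B, x ≠ v → x ∈ T) :
    ∃ C ∈ 𝓕, u ∈ C ∧ ∀ x ∈ C, x ≠ u → x ∈ T := by
  classical
  induction hk : (A.filter fun v => v ≠ u ∧ v ∉ T).card using Nat.strong_induction_on
    generalizing A with
  | _ k ih =>
    by_cases h : ∀ x ∈ A, x ≠ u → x ∈ T
    · exact ⟨A, hA, huA, h⟩
    · push Not at h
      obtain ⟨v, hvA, hvu, hvT⟩ := h
      obtain ⟨B, hB, hvB, hBT⟩ := hT v hvA hvu hvT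
      obtain ⟨C, hC, hvC, huC, hCs⟩ := h𝓕 A hA B hB v hvA hvB u huA
        (fun h => huT (hBT u h hvu.symm))
      have hCA : ∀ x ∈ C, x ∉ T → x ∈ A := fun x hx hxT =>
        (hCs x hx).resolve_right fun h => hxT (hBT x h fun h' => hvC (h' ▸ hx))
      refine ih _ ?_ hC huC (fun x hx hxu hxT => hT x (hCA x hx hxT) hxu hxT) rfl
      rw [← hk]
      refine Finset.card_lt_card ⟨fun x hx => ?_, fun hsub => ?_⟩
      · simp only [Finset.mem_filter] at hx ⊢
        exact ⟨hCA x hx.1 hx.2.2, hx.2⟩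
      · have := hsub (Finset.mem_filter.2 ⟨hvA, hvu, hvT⟩)
        exact hvC (Finset.mem_filter.1 this).1

/-- `u` is a leading element of `𝓕`: the unique element of largest key in some member of `𝓕`. -/
def IsLead {α : Type*} [LinearOrder α] (𝓕 : Set (Finset M)) (key : M → α) (u : M) : Prop :=
  ∃ A ∈ 𝓕, u ∈ A ∧ ∀ x ∈ A, x ≠ u → key x < key u

/-- The greedy bound: a set containing the non-leading elements of `E` spans `E`, and so is at least
as large as any independent subset of `E`. Here `E` has to be closed under
passing to elements with smaller key in members of `𝓕`. -/
theorem Indep.card_le_card_not_isLead {α : Type*} [LinearOrder α] {𝓕 : Set (Finset M)}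
    (h𝓕 : HasElimination 𝓕) (key : M → α) {E : Finset M}
    (hE : ∀ u ∈ E, ∀ A ∈ 𝓕, u ∈ A → (∀ x ∈ A, x ≠ u → key x < key u) → A ⊆ E)
    {B : Finset M} (hB : Indep 𝓕 B) (hBE : B ⊆ E) {T : Finset M}
    (hT : ∀ u ∈ E, ¬ IsLead 𝓕 key u → u ∈ T) : B.card ≤ T.card := by
  classical
  refine hB.card_le_of_spanned h𝓕 ?_
  suffices H : ∀ k, ∀ u ∈ E, (E.filter fun x => key x < key u).card = k → u ∉ T →
      ∃ A ∈ 𝓕, u ∈ A ∧ ∀ x ∈ A, x ≠ u → x ∈ T from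
    fun w hw hwT => H _ w (hBE hw) rfl hwT
  intro k
  induction k using Nat.strong_induction_on with
  | _ k ih =>
    intro u hu hk huT
    obtain ⟨A, hA, huA, hlt⟩ := not_not.1 (mt (hT u hu) huT)
    have hAE := hE u hu A hA huA hlt
    refine h𝓕.exists_spanned (T := (T : Set M)) (by simpa using huT) hA huA ?_
    intro v hvA hvu hvT
    refine ih _ ?_ v (hAE hvA) rfl (by simpa using hvT)
    rw [← hk]
    refine Finset.card_lt_card ⟨fun x hx => ?_, fun hsub => ?_⟩
    · simp only [Finset.mem_filter] at hx ⊢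
      exact ⟨hx.1, hx.2.trans (hlt v hvA hvu)⟩
    · have := hsub (Finset.mem_filter.2 ⟨hAE hvA, hlt v hvA hvu⟩)
      exact lt_irrefl _ (Finset.mem_filter.1 this).2

/-- The rank of `E` is the number of its non-leading elements. -/
theorem rank_eq_card_not_isLead {α : Type*} [LinearOrder α] {𝓕 : Set (Finset M)}
    (h𝓕 : HasElimination 𝓕) {key : M → α} (hkey : key.Injective) {E : Finset M}
    (hE : ∀ u ∈ E, ∀ A ∈ 𝓕, u ∈ A → (∀ x ∈ A, x ≠ u → key x < key u) → A ⊆ E)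
    {T : Finset M} (hT : ∀ u, u ∈ T ↔ u ∈ E ∧ ¬ IsLead 𝓕 key u) : rank 𝓕 E = T.card := by
  refine le_antisymm (rank_le fun B hBE hB => ?_) (Indep.card_le_rank ?_ ?_)
  · exact hB.card_le_card_not_isLead h𝓕 key hE hBE fun u hu hl => (hT u).2 ⟨hu, hl⟩
  · intro A hA hAT
    by_contra hne
    obtain ⟨u, hu, hmax⟩ := A.exists_max_image key (Finset.nonempty_iff_ne_empty.2 hne)
    exact ((hT u).1 (hAT hu)).2 ⟨A, hA, hu, fun x hx hxu =>
      lt_of_le_of_ne (hmax x hx) fun h => hxu (hkey h)⟩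
  · exact fun u hu => ((hT u).1 hu).1

end Families

/-! ### Elimination is inherited by projections -/

theorem HasElimination.image_map {M M' : Type*} {𝓕 : Set (Finset M)} (h𝓕 : HasElimination 𝓕)
    (e : M ↪ M') : HasElimination (Finset.map e '' 𝓕) := by
  rintro _ ⟨A, hA, rfl⟩ _ ⟨B, hB, rfl⟩ u' hu' huB w' hw' hwB
  obtain ⟨u, hu, rfl⟩ := Finset.mem_map.1 hu'
  obtain ⟨w, hw, rfl⟩ := Finset.mem_map.1 hw'
  rw [Finset.mem_map' e] at huB hwB
  obtain ⟨C, hC, huC, hwC, hCs⟩ := h𝓕 A hA B hB u hu huB w hw hwB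
  refine ⟨_, ⟨C, hC, rfl⟩, by simpa using huC, by simpa using hwC, fun x' hx' => ?_⟩
  obtain ⟨x, hx, rfl⟩ := Finset.mem_map.1 hx'
  simpa using hCs x hx

/-- The translate of a subset of `N × ℕ` by `i` in the second coordinate. -/
def shiftSnd {N : Type*} (i : ℕ) : N × ℕ ↪ N × ℕ where
  toFun x := (x.1, x.2 + i)
  inj' := by
    rintro ⟨x, k⟩ ⟨y, l⟩ h
    simpa using h

theorem shiftSnd_apply {N : Type*} (i : ℕ) (x : N × ℕ) : shiftSnd i x = (x.1, x.2 + i) := rfl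

/-- Elimination passes to the projection along the second coordinate, for families that are stable
under translation in that coordinate.

Let `u` lie in the projections of `A` and `B`, and `w` only in that of `A`, and let all heights be
at most `K`.  In the contraction of `𝓕` to the `4 * K + 2` points of height at most `2 * K` over `u`
and `w`, the translates of `A` and `B` by `0, …, K` have `2 * K + 2` distinct leading elements, so
that the rank is at most `2 * K` and the `2 * K + 1` points over `w` are dependent. -/
theorem HasElimination.image_fst {N : Type*} [DecidableEq N] {𝓕 : Set (Finset (N × ℕ))} (h𝓕 : HasElimination 𝓕)
    (hshift : ∀ A ∈ 𝓕, ∀ i, A.map (shiftSnd i) ∈ 𝓕) :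
    HasElimination (Finset.image Prod.fst '' 𝓕) := by
  rintro _ ⟨A, hA, rfl⟩ _ ⟨B, hB, rfl⟩ u huA huB w hwA hwB
  have huw : u ≠ w := fun h => hwB (h ▸ huB)
  obtain ⟨K, hKA, hKB⟩ : ∃ K, (∀ x ∈ A, x.2 ≤ K) ∧ ∀ x ∈ B, x.2 ≤ K :=
    ⟨A.sup Prod.snd ⊔ B.sup Prod.snd,
      fun x hx => le_sup_of_le_left (Finset.le_sup (f := Prod.snd) hx),
      fun x hx => le_sup_of_le_right (Finset.le_sup (f := Prod.snd) hx)⟩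
  -- the highest points of `A` over `w` and of `B` over `u`
  have top : ∀ (D : Finset (N × ℕ)) (v : N), v ∈ D.image Prod.fst →
      ∃ k, (v, k) ∈ D ∧ ∀ l, (v, l) ∈ D → l ≤ k := by
    intro D v hv
    obtain ⟨⟨v', k'⟩, hk', rfl⟩ := Finset.mem_image.1 hv
    obtain ⟨x, hx, hmax⟩ := (D.filter fun x => x.1 = v').exists_max_image Prod.snd
      ⟨_, Finset.mem_filter.2 ⟨hk', rfl⟩⟩
    obtain ⟨hxD, hxv⟩ := Finset.mem_filter.1 hx
    exact ⟨x.2, by rwa [← hxv], fun l hl => hmax _ (Finset.mem_filter.2 ⟨hl, rfl⟩)⟩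
  obtain ⟨a, haA, hamax⟩ := top A w hwA
  obtain ⟨b, hbB, hbmax⟩ := top B u huB
  have haK := hKA _ haA
  have hbK := hKB _ hbB
  set 𝓒 : Set (Finset (N × ℕ)) := {C | C ∈ 𝓕 ∧ ∀ x ∈ C, x.2 ≤ 2 * K ∧
    (x.1 ∈ A.image Prod.fst ∨ x.1 ∈ B.image Prod.fst)} with h𝓒
  set res : Finset (N × ℕ) → Finset (N × ℕ) := fun C => C.filter fun x => x.1 = u ∨ x.1 = w
    with hres
  have mem_res : ∀ C x, x ∈ res C ↔ x ∈ C ∧ (x.1 = u ∨ x.1 = w) := fun C x => by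
    simp [hres]
  have helim : HasElimination (res '' 𝓒) := by
    rintro _ ⟨C, hC, rfl⟩ _ ⟨D, hD, rfl⟩ x hxC hxD y hyC hyD
    rw [mem_res] at hxC hxD hyC hyD
    obtain ⟨G, hG, hxG, hyG, hGs⟩ := h𝓕 C hC.1 D hD.1 x hxC.1 hxD.1 y hyC.1
      (fun h => hyD ⟨h, hyC.2⟩)
    refine ⟨_, ⟨G, ⟨hG, fun z hz => (hGs z hz).elim (hC.2 z) (hD.2 z)⟩, rfl⟩,
      fun h => hxG ((mem_res _ _).1 h).1, (mem_res _ _).2 ⟨hyG, hyC.2⟩, fun z hz => ?_⟩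
    rw [mem_res] at hz
    exact (hGs z hz.1).imp (fun h => (mem_res _ _).2 ⟨h, hz.2⟩) fun h => (mem_res _ _).2 ⟨h, hz.2⟩
  set E : Finset (N × ℕ) := {u, w} ×ˢ Finset.range (2 * K + 1) with hE
  set L : Finset (N × ℕ) := {w} ×ˢ Finset.Icc a (a + K) ∪ {u} ×ˢ Finset.Icc b (b + K) with hL
  have hLE : L ⊆ E := by
    rintro ⟨x, k⟩ hx
    simp only [hL, hE, Finset.mem_union, Finset.mem_product, Finset.mem_singleton, Finset.mem_Icc,
      Finset.mem_insert, Finset.mem_range] at hx ⊢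
    rcases hx with ⟨h1, h2⟩ | ⟨h1, h2⟩
    · exact ⟨Or.inr h1, by omega⟩
    · exact ⟨Or.inl h1, by omega⟩
  have hcardE : E.card = 2 * (2 * K + 1) := by
    rw [hE, Finset.card_product, Finset.card_pair huw, Finset.card_range]
  have hcardL : L.card = 2 * (K + 1) := by
    rw [hL, Finset.card_union_of_disjoint, Finset.card_product, Finset.card_product,
      Finset.card_singleton, Finset.card_singleton, Nat.card_Icc, Nat.card_Icc]
    · omega
    · rw [Finset.disjoint_left]
      rintro ⟨x, k⟩ h1 h2
      simp only [Finset.mem_product, Finset.mem_singleton] at h1 h2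
      exact huw (h2.1.symm.trans h1.1)
  -- the points over `w` come after those over `u`; points of one fibre are ordered by height
  set key : N × ℕ → ℕ ×ₗ ℕ := fun x => toLex (if x.1 = w then 1 else 0, x.2) with hkey
  have hshift𝓒 : ∀ D ∈ 𝓕, (∀ x ∈ D, x.2 ≤ K) →
      (∀ x ∈ D, x.1 ∈ A.image Prod.fst ∨ x.1 ∈ B.image Prod.fst) → ∀ i ≤ K,
      D.map (shiftSnd i) ∈ 𝓒 := by
    intro D hD hDK hDs i hi
    refine ⟨hshift D hD i, fun x hx => ?_⟩
    obtain ⟨y, hy, rfl⟩ := Finset.mem_map.1 hx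
    have := hDK y hy
    exact ⟨by simp only [shiftSnd_apply]; omega, hDs y hy⟩
  have mem_shift : ∀ (D : Finset (N × ℕ)) i x k, (x, k) ∈ D.map (shiftSnd i) →
      ∃ l, (x, l) ∈ D ∧ k = l + i := by
    intro D i x k h
    obtain ⟨⟨y, l⟩, hy, hyx⟩ := Finset.mem_map.1 h
    simp only [shiftSnd_apply, Prod.mk.injEq] at hyx
    exact ⟨l, hyx.1 ▸ hy, hyx.2.symm⟩
  have hlead : ∀ x ∈ L, IsLead (res '' 𝓒) key x := by
    rintro ⟨x, k⟩ hx
    simp only [hL, Finset.mem_union, Finset.mem_product, Finset.mem_singleton,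
      Finset.mem_Icc] at hx
    rcases hx with ⟨rfl, h1, h2⟩ | ⟨rfl, h1, h2⟩
    · refine ⟨_, ⟨_, hshift𝓒 A hA hKA (fun y hy => Or.inl (Finset.mem_image_of_mem _ hy)) (k - a)
        (by omega), rfl⟩, (mem_res _ _).2 ⟨Finset.mem_map.2 ⟨_, haA, ?_⟩, Or.inr rfl⟩, ?_⟩
      · simp only [shiftSnd_apply, Prod.mk.injEq, true_and]
        omega
      · rintro ⟨y, l⟩ hy hne
        obtain ⟨hy, hyuw⟩ := (mem_res _ _).1 hy
        obtain ⟨m, hm, rfl⟩ := mem_shift _ _ _ _ hy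
        simp only [hkey, Prod.Lex.toLex_lt_toLex]
        rcases hyuw with rfl | rfl
        · left; simp [huw]
        · right
          have := hamax m hm
          refine ⟨by simp, lt_of_le_of_ne (by omega) fun h => hne ?_⟩
          rw [h]
    · refine ⟨_, ⟨_, hshift𝓒 B hB hKB (fun y hy => Or.inr (Finset.mem_image_of_mem _ hy)) (k - b)
        (by omega), rfl⟩, (mem_res _ _).2 ⟨Finset.mem_map.2 ⟨_, hbB, ?_⟩, Or.inl rfl⟩, ?_⟩
      · simp only [shiftSnd_apply, Prod.mk.injEq, true_and]
        omega
      · rintro ⟨y, l⟩ hy hne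
        obtain ⟨hy, hyuw⟩ := (mem_res _ _).1 hy
        obtain ⟨m, hm, rfl⟩ := mem_shift _ _ _ _ hy
        simp only [hkey, Prod.Lex.toLex_lt_toLex]
        rcases hyuw with rfl | rfl
        · right
          have := hbmax m hm
          refine ⟨by simp, lt_of_le_of_ne (by omega) fun h => hne ?_⟩
          rw [h]
        · exact absurd (Finset.mem_image_of_mem Prod.fst hm) hwB
  -- the fibre over `w` has more points than there are non-leading elements
  have hdep : ¬ Indep (res '' 𝓒) ({w} ×ˢ Finset.range (2 * K + 1)) := by
    intro hind
    have := hind.card_le_card_not_isLead helim key (E := E) (T := E \ L) ?_ ?_ ?_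
    · rw [Finset.card_sdiff_of_subset hLE, hcardE, hcardL, Finset.card_product,
        Finset.card_singleton, Finset.card_range] at this
      omega
    · rintro x - _ ⟨C, hC, rfl⟩ - - y hy
      obtain ⟨hyC, hy⟩ := (mem_res _ _).1 hy
      have := (hC.2 y hyC).1
      simp only [hE, Finset.mem_product, Finset.mem_insert, Finset.mem_singleton, Finset.mem_range]
      exact ⟨hy, by omega⟩
    · exact Finset.product_subset_product_left (by simp)
    · exact fun x hx hxl => Finset.mem_sdiff.2 ⟨hx, fun h => hxl (hlead x h)⟩
  simp only [Indep, not_forall] at hdep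
  obtain ⟨_, ⟨C, hC, rfl⟩, hCW, hCne⟩ := hdep
  obtain ⟨y, hy⟩ := Finset.nonempty_iff_ne_empty.2 hCne
  have hfst : ∀ x ∈ res C, x.1 = w := fun x hx => by
    simpa using (Finset.mem_product.1 (hCW hx)).1
  refine ⟨_, ⟨C, hC.1, rfl⟩, fun h => ?_, ?_, fun x hx => ?_⟩
  · obtain ⟨x, hx, rfl⟩ := Finset.mem_image.1 h
    exact huw (hfst x ((mem_res _ _).2 ⟨hx, Or.inl rfl⟩))
  · rw [← hfst y hy]
    exact Finset.mem_image_of_mem _ ((mem_res _ _).1 hy).1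
  · obtain ⟨y, hy, rfl⟩ := Finset.mem_image.1 hx
    exact (hC.2 y hy).2

/-! ### Eventually polynomial functions -/

/-- The function `f` agrees with a polynomial at all large arguments. -/
def EventuallyPoly (f : ℕ → ℕ) : Prop :=
  ∃ p : Polynomial ℚ, ∀ᶠ d in atTop, (f d : ℚ) = p.eval (d : ℚ)

namespace EventuallyPoly

theorem congr {f g : ℕ → ℕ} (hf : EventuallyPoly f) (h : ∀ᶠ d in atTop, g d = f d) :
    EventuallyPoly g := by
  obtain ⟨p, hp⟩ := hf
  refine ⟨p, ?_⟩
  filter_upwards [hp, h] with d h1 h2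
  rw [h2, h1]

theorem const (c : ℕ) : EventuallyPoly fun _ => c :=
  ⟨Polynomial.C (c : ℚ), by simp⟩

theorem add {f g : ℕ → ℕ} (hf : EventuallyPoly f) (hg : EventuallyPoly g) :
    EventuallyPoly fun d => f d + g d := by
  obtain ⟨p, hp⟩ := hf
  obtain ⟨q, hq⟩ := hg
  refine ⟨p + q, ?_⟩
  filter_upwards [hp, hq] with d h1 h2
  simp [h1, h2]

theorem sum {ι : Type*} (s : Finset ι) {f : ι → ℕ → ℕ} (h : ∀ i ∈ s, EventuallyPoly (f i)) :
    EventuallyPoly fun d => ∑ i ∈ s, f i d := by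
  classical
  induction s using Finset.induction_on with
  | empty => simpa using const 0
  | insert i s hi ih =>
    simp only [Finset.sum_insert hi]
    exact (h i (Finset.mem_insert_self i s)).add
      (ih fun j hj => h j (Finset.mem_insert_of_mem hj))

theorem comp_sub {f : ℕ → ℕ} (hf : EventuallyPoly f) (k : ℕ) :
    EventuallyPoly fun d => f (d - k) := by
  obtain ⟨p, hp⟩ := hf
  refine ⟨p.comp (Polynomial.X - Polynomial.C (k : ℚ)), ?_⟩
  filter_upwards [(tendsto_sub_atTop_nat k).eventually hp, eventually_ge_atTop k] with d h1 h2
  rw [h1, Nat.cast_sub h2]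
  simp

/-- The sums of the values of a polynomial are given by a polynomial (Faulhaber). -/
theorem exists_eval_sum_range (p : Polynomial ℚ) :
    ∃ q : Polynomial ℚ, ∀ d : ℕ, ∑ j ∈ Finset.range d, p.eval (j : ℚ) = q.eval (d : ℚ) := by
  induction p using Polynomial.induction_on' with
  | add p q hp hq =>
    obtain ⟨p', hp'⟩ := hp
    obtain ⟨q', hq'⟩ := hq
    exact ⟨p' + q', fun d => by simp [Finset.sum_add_distrib, hp', hq']⟩
  | monomial m c =>
    refine ⟨Polynomial.C c * ∑ i ∈ Finset.range (m + 1),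
      Polynomial.C (bernoulli i * ((m + 1).choose i : ℚ) / (m + 1)) *
        Polynomial.X ^ (m + 1 - i), fun d => ?_⟩
    simp only [Polynomial.eval_monomial, ← Finset.mul_sum, sum_range_pow, Polynomial.eval_mul,
      Polynomial.eval_C, Polynomial.eval_finsetSum, Polynomial.eval_pow, Polynomial.eval_X]
    congr 1
    exact Finset.sum_congr rfl fun i _ => by ring

theorem sum_range {f : ℕ → ℕ} (hf : EventuallyPoly f) :
    EventuallyPoly fun d => ∑ j ∈ Finset.range d, f j := by
  obtain ⟨p, hp⟩ := hf
  obtain ⟨N, hN⟩ := eventually_atTop.1 hp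
  obtain ⟨q, hq⟩ := exists_eval_sum_range p
  refine ⟨q + Polynomial.C (∑ j ∈ Finset.range N, ((f j : ℚ) - p.eval (j : ℚ))), ?_⟩
  filter_upwards [eventually_ge_atTop N] with d hd
  obtain ⟨k, rfl⟩ := Nat.exists_eq_add_of_le hd
  rw [Polynomial.eval_add, ← hq, Polynomial.eval_C, Finset.sum_sub_distrib, Finset.sum_range_add,
    Finset.sum_range_add]
  have : ∑ x ∈ Finset.range k, (f (N + x) : ℚ) =
      ∑ x ∈ Finset.range k, p.eval ((N + x : ℕ) : ℚ) :=
    Finset.sum_congr rfl fun x _ => hN _ (by omega)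
  push_cast at this ⊢
  rw [this]
  ring

end EventuallyPoly

/-- If `q` is nonzero with nonnegative values, and `p (2 * d) ≥ (d + 1) * q d` for large `d`, then
the degree of `p` exceeds that of `q`. -/
theorem natDegree_lt_of_mul_eval_le {p q : Polynomial ℚ} (hq : q ≠ 0)
    (h0 : ∀ᶠ d : ℕ in atTop, 0 ≤ q.eval (d : ℚ))
    (h : ∀ᶠ d : ℕ in atTop, ((d : ℚ) + 1) * q.eval (d : ℚ) ≤ p.eval (2 * (d : ℚ))) :
    q.natDegree < p.natDegree := by
  have hcast := tendsto_natCast_atTop_atTop (R := ℚ)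
  have neg : ∀ r : Polynomial ℚ, 0 < r.degree → r.leadingCoeff < 0 →
      (∀ᶠ d : ℕ in atTop, 0 ≤ r.eval (d : ℚ)) → False := by
    intro r hr hl hpos
    have ht := (r.tendsto_atBot_of_leadingCoeff_nonpos hr hl.le).comp hcast
    obtain ⟨d, h1, h2⟩ := (hpos.and (ht.eventually_lt_atBot 0)).exists
    exact absurd h1 (not_le.2 h2)
  have hlc : 0 < q.leadingCoeff := by
    refine lt_of_le_of_ne (not_lt.1 fun hl => ?_) (Ne.symm (Polynomial.leadingCoeff_ne_zero.2 hq))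
    by_cases hd : 0 < q.degree
    · exact neg q hd hl h0
    · obtain ⟨d, hd0⟩ := h0.exists
      rw [Polynomial.eq_C_of_degree_le_zero (not_lt.1 hd)] at hd0 hl
      simp only [Polynomial.eval_C, Polynomial.leadingCoeff_C] at hd0 hl
      exact absurd hd0 (not_le.2 hl)
  by_contra hdeg
  set s : Polynomial ℚ := (Polynomial.X + 1) * q with hs
  set t : Polynomial ℚ := p.comp (Polynomial.C 2 * Polynomial.X) with ht
  have hX : (Polynomial.X + 1 : Polynomial ℚ).Monic := Polynomial.monic_X_add_C 1
  have hXd : (Polynomial.X + 1 : Polynomial ℚ).natDegree = 1 := Polynomial.natDegree_X_add_C 1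
  have hs0 : s ≠ 0 := mul_ne_zero hX.ne_zero hq
  have hsd : s.natDegree = q.natDegree + 1 := by
    rw [hs, hX.natDegree_mul' hq, hXd, add_comm]
  have hst : t.degree < s.degree := by
    rw [Polynomial.degree_eq_natDegree hs0, hsd]
    refine lt_of_le_of_lt Polynomial.degree_le_natDegree ?_
    have : t.natDegree = p.natDegree := by
      rw [ht, Polynomial.natDegree_comp, Polynomial.natDegree_C_mul_X _ (by norm_num), mul_one]
    rw [this]
    exact_mod_cast Nat.lt_succ_of_le (not_lt.1 hdeg)
  refine neg (t - s) ?_ ?_ ?_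
  · rw [Polynomial.degree_sub_eq_right_of_degree_lt hst, ← Polynomial.natDegree_pos_iff_degree_pos,
      hsd]
    omega
  · rw [Polynomial.leadingCoeff_sub_of_degree_lt' hst, hs, Polynomial.leadingCoeff_monic_mul hX]
    linarith
  · filter_upwards [h] with d hd
    simp only [hs, ht, Polynomial.eval_sub, Polynomial.eval_comp, Polynomial.eval_mul,
      Polynomial.eval_C, Polynomial.eval_X, Polynomial.eval_add, Polynomial.eval_one]
    linarith

/-! ### Counting monomials outside a monomial ideal -/

/-- The monomials in `n` variables of degree at most `d`. -/
noncomputable def degreeBall (n d : ℕ) : Finset (Fin n →₀ ℕ) :=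
  (Finsupp.finite_of_degree_le d).toFinset

@[simp] theorem mem_degreeBall {n d : ℕ} {u : Fin n →₀ ℕ} : u ∈ degreeBall n d ↔ u.degree ≤ d := by
  simp [degreeBall]

theorem degree_cons {n : ℕ} (k : ℕ) (u : Fin n →₀ ℕ) :
    (Finsupp.cons k u).degree = k + u.degree := by
  simp [Finsupp.degree_eq_sum, Fin.sum_univ_succ]

theorem cons_le_cons {n : ℕ} {k l : ℕ} {u v : Fin n →₀ ℕ} (hkl : k ≤ l) (huv : u ≤ v) :
    Finsupp.cons k u ≤ Finsupp.cons l v := by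
  intro i
  refine Fin.cases ?_ (fun i => ?_) i
  · simpa using hkl
  · simpa using huv i

open Classical in
/-- The number of standard monomials (those outside of a given monomial ideal) of degree at most
`d` is eventually polynomial in `d`.  The slices of the ideal by the exponent of the first
variable increase with that exponent, and become constant by Dickson's lemma. -/
theorem eventuallyPoly_card_degreeBall_filter {n : ℕ} {U : Set (Fin n →₀ ℕ)} (hU : IsUpperSet U) :
    EventuallyPoly fun d => ((degreeBall n d).filter (· ∉ U)).card := by
  induction n with
  | zero =>
    refine (EventuallyPoly.const ((degreeBall 0 0).filter (· ∉ U)).card).congr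
      (Eventually.of_forall fun d => ?_)
    congr 2
    ext u
    simp [Subsingleton.elim u 0]
  | succ n ih =>
    set V : ℕ → Set (Fin n →₀ ℕ) := fun k => {v | Finsupp.cons k v ∈ U} with hV
    have hVU : ∀ k, IsUpperSet (V k) := fun k v v' hvv' hv =>
      hU (cons_le_cons le_rfl hvv') hv
    have hVmono : Monotone V := fun k l hkl v hv => hU (cons_le_cons hkl le_rfl) hv
    obtain ⟨N, hN⟩ : ∃ N, ∀ k, N ≤ k → V k = V N := by
      have hfin : {v | Minimal (fun v => ∃ k, v ∈ V k) v}.Finite :=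
        WellQuasiOrderedLE.finite_of_isAntichain (setOfPred_minimal_antichain _)
      have hex : ∀ v ∈ {v | Minimal (fun v => ∃ k, v ∈ V k) v}, ∃ k, v ∈ V k :=
        fun v hv => hv.1
      choose! κ hκ using hex
      refine ⟨hfin.toFinset.sup κ, fun k hk => le_antisymm (fun v hv => ?_) (hVmono hk)⟩
      obtain ⟨m, hmv, hm⟩ := exists_minimal_le_of_wellFoundedLT
        (fun v => ∃ k, v ∈ V k) v ⟨k, hv⟩
      exact hVU _ hmv (hVmono (Finset.le_sup (hfin.mem_toFinset.2 hm)) (hκ m hm))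
    set h : ℕ → ℕ → ℕ := fun k d => ((degreeBall n d).filter (· ∉ V k)).card with hh
    have hcount : ∀ d, ((degreeBall (n + 1) d).filter (· ∉ U)).card =
        ∑ k ∈ Finset.range (d + 1), h k (d - k) := by
      intro d
      rw [Finset.card_eq_sum_card_fiberwise (f := fun u => u 0) (t := Finset.range (d + 1))]
      · refine Finset.sum_congr rfl fun k hk => ?_
        rw [Finset.mem_range] at hk
        symm
        refine Finset.card_bij (fun v _ => Finsupp.cons k v) ?_ ?_ ?_
        · intro v hv
          simp only [Finset.mem_filter, mem_degreeBall, degree_cons, Finsupp.cons_zero,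
            and_true] at hv ⊢
          exact ⟨by omega, hv.2⟩
        · exact fun v _ v' _ hvv' => Finsupp.cons_right_injective k hvv'
        · intro u hu
          simp only [Finset.mem_filter, mem_degreeBall] at hu
          obtain ⟨⟨hud, huU⟩, rfl⟩ := hu
          refine ⟨u.tail, ?_, Finsupp.cons_tail u⟩
          rw [← Finsupp.cons_tail u, degree_cons] at hud
          simp only [Finset.mem_filter, mem_degreeBall, hV, Set.mem_ofPred_eq, Finsupp.cons_tail]
          exact ⟨by omega, huU⟩
      · intro u hu
        simp only [Finset.coe_filter, mem_degreeBall, Set.mem_ofPred_eq] at hu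
        have := Finsupp.le_degree 0 u
        simp only [Finset.coe_range, Set.mem_Iio]
        omega
    refine (((EventuallyPoly.sum (Finset.range (N + 1)) fun k _ => (ih (hVU k)).comp_sub k)).add
      ((ih (hVU N)).sum_range.comp_sub N)).congr ?_
    filter_upwards [eventually_ge_atTop N] with d hd
    rw [hcount, ← Finset.sum_range_add_sum_Ico _ (show N + 1 ≤ d + 1 by omega)]
    congr 1
    rw [Finset.sum_Ico_eq_sum_range, ← Finset.sum_range_reflect, Nat.add_sub_add_right]
    refine Finset.sum_congr rfl fun j hj => ?_
    rw [Finset.mem_range] at hj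
    have hdj : d - (N + 1 + (d - N - 1 - j)) = j := by omega
    simp only [hh, hN _ (show N ≤ N + 1 + (d - N - 1 - j) by omega), hdj]

/-! ### Supports of tropical polynomials -/

section Supports

variable {M M' : Type*}

theorem ofReal_ne_zero (a : ℝ) : ofReal a ≠ 0 := fun h =>
  WithTop.coe_ne_top (congrArg Tropical.untrop h)

theorem exists_eq_ofReal {c : T} (hc : c ≠ 0) : ∃ a, c = ofReal a := by
  obtain ⟨a, ha⟩ := WithTop.ne_top_iff_exists.1
    (fun h : Tropical.untrop c = ⊤ => hc (Tropical.untrop_injective h))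
  exact ⟨a, Tropical.untrop_injective ha.symm⟩

theorem ofReal_mul (a b : ℝ) : ofReal a * ofReal b = ofReal (a + b) := rfl

theorem ofReal_zero : ofReal 0 = 1 := rfl

theorem support_add_eq_union {N : Type*} [DecidableEq N] (f g : N →₀ T) :
    (f + g).support = f.support ∪ g.support := by
  ext u
  simp only [Finsupp.mem_support_iff, Finsupp.add_apply, ne_eq, Tropical.add_eq_zero_iff,
    Finset.mem_union]
  tauto

/-- There is no cancellation in the tropical semiring, so that a substitution of monomials acts on
supports by taking the image. -/
theorem support_map_of_single [DecidableEq M'] (φ : AddMonoidAlgebra T M →+ AddMonoidAlgebra T M')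
    (π : M → M') (κ : M → T) (hκ : ∀ u, κ u ≠ 0)
    (hφ : ∀ u c, φ (.single u c) = .single (π u) (c * κ u)) (f : AddMonoidAlgebra T M) :
    (φ f).coeff.support = f.coeff.support.image π := by
  classical
  induction f using AddMonoidAlgebra.induction_linear with
  | zero => simp
  | add f g hf hg =>
    rw [map_add, AddMonoidAlgebra.coeff_add, AddMonoidAlgebra.coeff_add, support_add_eq_union,
      support_add_eq_union, hf, hg,
      Finset.image_union]
  | single u c =>
    rw [hφ, AddMonoidAlgebra.coeff_single, AddMonoidAlgebra.coeff_single]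
    by_cases hc : c = 0
    · simp [hc]
    · rw [Finsupp.support_single _ hc, Finsupp.support_single _ (mul_ne_zero hc (hκ u)),
        Finset.image_singleton]

variable [AddCommMonoid M] [AddCommMonoid M']

/-- The family of the supports of the members of an ideal. -/
def supports (I : Ideal (AddMonoidAlgebra T M)) : Set (Finset M) :=
  {A | ∃ f ∈ I, f.coeff.support = A}

theorem image_add_mem_supports [IsLeftCancelAdd M] [DecidableEq M]
    {I : Ideal (AddMonoidAlgebra T M)} {A : Finset M} (hA : A ∈ supports I) (m : M) :
    A.image (m + ·) ∈ supports I := by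
  obtain ⟨f, hf, rfl⟩ := hA
  exact ⟨_, I.mul_mem_left (.single m 1) hf,
    AddMonoidAlgebra.support_coeff_single_mul_eq_image f (by simp) (.all m)⟩

theorem support_smul {c : T} (hc : c ≠ 0) (f : AddMonoidAlgebra T M) :
    (c • f).coeff.support = f.coeff.support := by
  ext u
  simp [hc]

theorem hasElimination_supports {I : Ideal (AddMonoidAlgebra T M)}
    (hI : ∀ f ∈ I, ∀ g ∈ I, ∀ u, f.coeff u = g.coeff u → f.coeff u ≠ 0 →
      ∃ h ∈ I, IsElimination u (fun v => f.coeff v) (fun v => g.coeff v) (fun v => h.coeff v)) :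
    HasElimination (supports I) := by
  rintro _ ⟨f, hf, rfl⟩ _ ⟨g, hg, rfl⟩ u huf hug w hwf hwg
  rw [Finsupp.mem_support_iff] at huf hug hwf
  obtain ⟨a, ha⟩ := exists_eq_ofReal huf
  obtain ⟨b, hb⟩ := exists_eq_ofReal hug
  -- rescale `g` so that the coefficients of `u` agree
  have hc := ofReal_ne_zero (a - b)
  rw [← support_smul hc g] at hwg ⊢
  rw [Finsupp.notMem_support_iff] at hwg
  obtain ⟨h, hh, h0, hv⟩ := hI f hf (ofReal (a - b) • g) (Submodule.smul_of_tower_mem I _ hg) u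
    (by rw [AddMonoidAlgebra.coeff_smul_apply, ha, hb, smul_eq_mul, ofReal_mul, sub_add_cancel]) huf
  refine ⟨_, ⟨h, hh, rfl⟩, by simpa using h0, ?_, fun x hx => ?_⟩
  · have := (hv w).2 (by simpa only [hwg] using hwf)
    simp only [hwg] at this
    rw [Finsupp.mem_support_iff, this, min_eq_left (show f.coeff w ≤ 0 from Tropical.le_zero _)]
    exact hwf
  · simp only [Finsupp.mem_support_iff] at hx ⊢
    by_contra! hxfg
    refine hx (le_antisymm (Tropical.le_zero _) ?_)
    simpa only [hxfg.1, hxfg.2, min_self] using (hv x).1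

theorem supports_imageIdeal [DecidableEq M']
    (φ : AddMonoidAlgebra T M →+* AddMonoidAlgebra T M') (hφ : Function.Surjective φ)
    (π : M → M') (κ : M → T) (hκ : ∀ u, κ u ≠ 0)
    (hφ' : ∀ u c, φ (.single u c) = .single (π u) (c * κ u)) (I : Ideal (AddMonoidAlgebra T M)) :
    supports (imageIdeal φ hφ I) = Finset.image π '' supports I := by
  ext A
  constructor
  · rintro ⟨_, ⟨f, hf, rfl⟩, rfl⟩
    exact ⟨_, ⟨f, hf, rfl⟩, (support_map_of_single φ.toAddMonoidHom π κ hκ hφ' f).symm⟩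
  · rintro ⟨_, ⟨f, hf, rfl⟩, rfl⟩
    exact ⟨_, ⟨f, hf, rfl⟩, support_map_of_single φ.toAddMonoidHom π κ hκ hφ' f⟩

/-- A proper ideal contains no nonzero constant, as these are units. -/
theorem singleton_zero_notMem_supports {I : Ideal (AddMonoidAlgebra T M)} (hI : I ≠ ⊤) :
    {0} ∉ supports I := by
  rintro ⟨f, hf, hf0⟩
  obtain ⟨hc, hfs⟩ := Finsupp.support_eq_singleton.1 hf0
  obtain ⟨a, ha⟩ := exists_eq_ofReal hc
  refine hI (Ideal.eq_top_of_isUnit_mem _ hf (IsUnit.of_mul_eq_one (.single 0 (ofReal (-a))) ?_))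
  have : f = .single 0 (ofReal a) := by
    rw [← AddMonoidAlgebra.coeff_inj, AddMonoidAlgebra.coeff_single, ← ha]
    exact hfs
  rw [this, AddMonoidAlgebra.single_mul_single, ofReal_mul, add_neg_cancel, ofReal_zero, add_zero,
    AddMonoidAlgebra.one_def]

end Supports

/-! ### Forgetting the last variable -/

/-- The exponent vector without its last entry. -/
noncomputable def dropLast {n : ℕ} (u : Fin (n + 1) →₀ ℕ) : Fin n →₀ ℕ :=
  Finsupp.equivFunOnFinite.symm fun i => u i.castSucc

@[simp] theorem dropLast_apply {n : ℕ} (u : Fin (n + 1) →₀ ℕ) (i : Fin n) :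
    dropLast u i = u i.castSucc := rfl

theorem degree_dropLast_add {n : ℕ} (u : Fin (n + 1) →₀ ℕ) :
    (dropLast u).degree + u (Fin.last n) = u.degree := by
  simp [Finsupp.degree_eq_sum, Fin.sum_univ_castSucc]

/-- The exponent vector `v` extended by the last entry `k`. -/
noncomputable def appendLast {n : ℕ} (v : Fin n →₀ ℕ) (k : ℕ) : Fin (n + 1) →₀ ℕ :=
  Finsupp.equivFunOnFinite.symm (Fin.snoc (α := fun _ => ℕ) v k)

@[simp] theorem dropLast_appendLast {n : ℕ} (v : Fin n →₀ ℕ) (k : ℕ) :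
    dropLast (appendLast v k) = v := by
  ext i
  simp [appendLast]

@[simp] theorem appendLast_last {n : ℕ} (v : Fin n →₀ ℕ) (k : ℕ) :
    appendLast v k (Fin.last n) = k := by
  simp [appendLast]

/-- An exponent vector in `n + 1` variables, split into the first `n` entries and the last one. -/
noncomputable def splitLast (n : ℕ) : (Fin (n + 1) →₀ ℕ) ↪ (Fin n →₀ ℕ) × ℕ where
  toFun u := (dropLast u, u (Fin.last n))
  inj' u v h := by
    rw [Prod.mk.injEq] at h
    ext i
    refine Fin.lastCases h.2 (fun i => ?_) i
    exact DFunLike.congr_fun h.1 i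

theorem splitLast_apply {n : ℕ} (u : Fin (n + 1) →₀ ℕ) :
    splitLast n u = (dropLast u, u (Fin.last n)) := rfl

theorem hasElimination_image_dropLast {n : ℕ} {I : Ideal (Poly (n + 1))}
    (hI : HasElimination (supports I)) :
    HasElimination (Finset.image dropLast '' supports I) := by
  have h := (hI.image_map (splitLast n)).image_fst ?_
  · convert h using 1
    rw [Set.image_image]
    refine Set.image_congr fun A _ => ?_
    rw [Finset.map_eq_image, Finset.image_image]
    rfl
  · rintro _ ⟨A, hA, rfl⟩ i
    refine ⟨_, image_add_mem_supports hA (Finsupp.single (Fin.last n) i), ?_⟩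
    rw [Finset.map_eq_image, Finset.map_eq_image, Finset.map_eq_image, Finset.image_image,
      Finset.image_image]
    refine Finset.image_congr fun u _ => ?_
    refine Prod.ext ?_ ?_
    · ext j
      simp [splitLast_apply, shiftSnd_apply, (Fin.castSucc_lt_last j).ne]
    · simp [splitLast_apply, shiftSnd_apply, add_comm]

theorem supports_specializePoly {n : ℕ} (a : ℝ) (I : Ideal (Poly (n + 1))) :
    supports (specializePoly a I) = Finset.image dropLast '' supports I := by
  refine supports_imageIdeal (substPoly a) (substPoly_surjective a) dropLast
    (fun u => ofReal a ^ u (Fin.last n)) (fun u => pow_ne_zero _ (ofReal_ne_zero a))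
    (fun u c => ?_) I
  rw [MvPolynomial.single_eq_monomial, substPoly, MvPolynomial.eval₂Hom_monomial,
    Finsupp.prod_fintype _ _ (fun _ => pow_zero _), Fin.prod_univ_castSucc]
  simp only [Fin.lastCases_castSucc, Fin.lastCases_last]
  rw [← MvPolynomial.C_pow, MvPolynomial.single_eq_monomial, MvPolynomial.monomial_eq,
    Finsupp.prod_fintype _ _ (fun _ => pow_zero _), MvPolynomial.C_mul]
  simp only [dropLast_apply]
  ring

/-! ### Laurent polynomials -/

/-- Exponent vectors in `ℕ ^ n` as exponent vectors in `ℤ ^ n`. -/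
def toIntExp (n : ℕ) : (Fin n →₀ ℕ) ↪ (Fin n → ℤ) where
  toFun u i := u i
  inj' u v h := by
    ext i
    exact Int.natCast_inj.1 (congrFun h i)

theorem toIntExp_apply {n : ℕ} (u : Fin n →₀ ℕ) (i : Fin n) : toIntExp n u i = u i := rfl

theorem exists_map_toIntExp {n : ℕ} {A : Finset (Fin n → ℤ)} (hA : ∀ u ∈ A, ∀ i, 0 ≤ u i) :
    ∃ B : Finset (Fin n →₀ ℕ), B.map (toIntExp n) = A := by
  classical
  refine ⟨A.image fun u => Finsupp.equivFunOnFinite.symm fun i => (u i).toNat, ?_⟩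
  rw [Finset.map_eq_image, Finset.image_image]
  refine (Finset.image_congr fun u hu => ?_).trans Finset.image_id
  funext i
  simpa [toIntExp_apply] using hA u hu i

theorem toLaurent_single {n : ℕ} (u : Fin n →₀ ℕ) (c : T) :
    toLaurent n (.single u c) = .single (toIntExp n u) c := by
  have hpow : ∀ (m : Fin n → ℤ) (k : ℕ), (AddMonoidAlgebra.single m 1 : Laurent n) ^ k =
      .single (k • m) 1 := fun m k => by
    rw [AddMonoidAlgebra.single_pow, one_pow]
  have hprod : ∀ (s : Finset (Fin n)) (m : Fin n → Fin n → ℤ),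
      ∏ i ∈ s, (AddMonoidAlgebra.single (m i) 1 : Laurent n) = .single (∑ i ∈ s, m i) 1 := by
    intro s m
    classical
    induction s using Finset.induction_on with
    | empty => simp [AddMonoidAlgebra.one_def]
    | insert i s hi ih =>
      rw [Finset.prod_insert hi, ih, Finset.sum_insert hi, AddMonoidAlgebra.single_mul_single,
        one_mul]
  rw [MvPolynomial.single_eq_monomial]
  change MvPolynomial.aeval _ _ = _
  rw [MvPolynomial.aeval_monomial, Finsupp.prod_fintype _ _ (fun _ => pow_zero _)]
  simp only [hpow, hprod]
  rw [AddMonoidAlgebra.coe_algebraMap, Function.comp_apply, Algebra.algebraMap_self,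
    RingHom.id_apply, AddMonoidAlgebra.single_mul_single, zero_add, mul_one]
  congr 1
  funext i
  simp [Finset.sum_apply, Pi.single_apply, toIntExp_apply]

theorem support_toLaurent {n : ℕ} (f : Poly n) :
    (toLaurent n f).coeff.support = f.support.map (toIntExp n) := by
  classical
  rw [Finset.map_eq_image]
  exact support_map_of_single (toLaurent n).toAddMonoidHom (toIntExp n) (fun _ => 1)
    (fun _ => one_ne_zero) (fun u c => by rw [mul_one]; exact toLaurent_single u c) f

theorem exists_toLaurent_eq {n : ℕ} {A : Finset (Fin n →₀ ℕ)} {g : Laurent n}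
    (hg : g.coeff.support = A.map (toIntExp n)) : ∃ f : Poly n, toLaurent n f = g := by
  refine ⟨∑ u ∈ A, .single u (g.coeff (toIntExp n u)), ?_⟩
  simp only [map_sum, toLaurent_single]
  conv_rhs => rw [← AddMonoidAlgebra.sum_coeff_single g, Finsupp.sum, hg, Finset.sum_map]

theorem mem_supports_affinePart {n : ℕ} {I : Ideal (Laurent n)} {A : Finset (Fin n →₀ ℕ)} :
    A ∈ supports (affinePart I) ↔ A.map (toIntExp n) ∈ supports I := by
  constructor
  · rintro ⟨f, hf, rfl⟩
    exact ⟨_, hf, support_toLaurent f⟩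
  · rintro ⟨g, hg, hA⟩
    obtain ⟨f, rfl⟩ := exists_toLaurent_eq hA
    rw [support_toLaurent, Finset.map_inj] at hA
    exact ⟨f, hg, hA⟩

theorem hasElimination_supports_affinePart {n : ℕ} {I : Ideal (Laurent n)}
    (hI : HasElimination (supports I)) : HasElimination (supports (affinePart I)) := by
  intro A hA B hB u huA huB w hwA hwB
  rw [mem_supports_affinePart] at hA hB
  obtain ⟨C, hC, huC, hwC, hCs⟩ := hI _ hA _ hB (toIntExp n u) (by simpa using huA)
    (by simpa using huB) (toIntExp n w) (by simpa using hwA) (by simpa using hwB)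
  obtain ⟨C, rfl⟩ : ∃ C' : Finset (Fin n →₀ ℕ), C'.map (toIntExp n) = C := by
    refine exists_map_toIntExp fun x hx i => ?_
    rcases hCs x hx with h | h <;>
    · obtain ⟨y, -, rfl⟩ := Finset.mem_map.1 h
      exact Int.natCast_nonneg _
  refine ⟨C, mem_supports_affinePart.2 hC, by simpa using huC, by simpa using hwC, fun x hx => ?_⟩
  simpa using hCs _ (Finset.mem_map_of_mem _ hx)

theorem image_init_map_toIntExp {n : ℕ} (A : Finset (Fin (n + 1) →₀ ℕ)) :
    (A.map (toIntExp (n + 1))).image (fun u => Fin.init (α := fun _ => ℤ) u) =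
      (A.image dropLast).map (toIntExp n) := by
  classical
  rw [Finset.map_eq_image, Finset.map_eq_image, Finset.image_image, Finset.image_image]
  rfl

/-- Specialization commutes with passing to the polynomial part, on the level of supports:
multiplying by a power of the last variable makes its exponents nonnegative and does not change
the specialization up to a unit. -/
theorem supports_affinePart_specializeLaurent {n : ℕ} (a : ℝ) (I : Ideal (Laurent (n + 1))) :
    supports (affinePart (specializeLaurent a I)) =
      Finset.image dropLast '' supports (affinePart I) := by
  have hsupp : supports (specializeLaurent a I) =
      Finset.image (fun u => Fin.init (α := fun _ => ℤ) u) '' supports I :=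
    supports_imageIdeal (substLaurent a) (substLaurent_surjective a) _
      (fun u => ofReal ((u (Fin.last n) : ℝ) * a)) (fun _ => ofReal_ne_zero _)
      (fun u c => substLaurent_single a u c) I
  ext A
  rw [mem_supports_affinePart, hsupp]
  constructor
  · rintro ⟨B, hB, hBA⟩
    have hinit : ∀ u ∈ B, ∀ i : Fin n, 0 ≤ u i.castSucc := fun u hu i => by
      have : Fin.init (α := fun _ => ℤ) u ∈ A.map (toIntExp n) :=
        hBA ▸ Finset.mem_image_of_mem _ hu
      obtain ⟨v, -, hv⟩ := Finset.mem_map.1 this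
      have := congrFun hv i
      simp only [Fin.init] at this
      rw [← this]
      exact Int.natCast_nonneg _
    obtain ⟨k, hk⟩ : ∃ k : ℕ, ∀ u ∈ B, -(k : ℤ) ≤ u (Fin.last n) := by
      refine ⟨B.sup fun u => (-u (Fin.last n)).toNat, fun u hu => ?_⟩
      have := Finset.le_sup (f := fun u : Fin (n + 1) → ℤ => (-u (Fin.last n)).toNat) hu
      omega
    set m : Fin (n + 1) → ℤ := Pi.single (Fin.last n) (k : ℤ) with hm
    have hm0 : ∀ i : Fin n, m i.castSucc = 0 := fun i => by
      simp [hm, (Fin.castSucc_lt_last i).ne]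
    have hmB : ∀ u ∈ B.image (m + ·), ∀ i, 0 ≤ u i := by
      intro u hu i
      obtain ⟨v, hv, rfl⟩ := Finset.mem_image.1 hu
      refine Fin.lastCases ?_ (fun i => ?_) i
      · have := hk v hv
        simp only [hm, Pi.add_apply, Pi.single_eq_same]
        omega
      · simpa [hm0] using hinit v hv i
    obtain ⟨D, hD⟩ := exists_map_toIntExp hmB
    refine ⟨D, mem_supports_affinePart.2 (hD ▸ image_add_mem_supports hB m), ?_⟩
    refine Finset.map_injective (toIntExp n) ?_
    rw [← image_init_map_toIntExp, hD, Finset.image_image, ← hBA]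
    refine Finset.image_congr fun u _ => ?_
    funext i
    simp [Fin.init, hm0]
  · rintro ⟨D, hD, rfl⟩
    exact ⟨_, mem_supports_affinePart.1 hD, image_init_map_toIntExp D⟩

/-! ### The Hilbert function as a rank function -/

/-- The substitution `x₀ = 1`. -/
noncomputable def dehomogenize (n : ℕ) : Poly (n + 1) →+* Poly n :=
  MvPolynomial.eval₂Hom MvPolynomial.C (Fin.cases 1 fun i => MvPolynomial.X i)

theorem dehomogenize_monomial {n : ℕ} (u : Fin (n + 1) →₀ ℕ) (c : T) :
    dehomogenize n (MvPolynomial.monomial u c) = MvPolynomial.monomial u.tail c := by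
  rw [dehomogenize, MvPolynomial.eval₂Hom_monomial,
    Finsupp.prod_fintype _ _ (fun _ => pow_zero _), Fin.prod_univ_succ, MvPolynomial.monomial_eq,
    Finsupp.prod_fintype _ _ (fun _ => pow_zero _)]
  simp [Finsupp.tail_apply]

theorem dehomogenize_homogenize {n : ℕ} (f : Poly n) : dehomogenize n (homogenize f) = f := by
  simp only [homogenize, map_sum, dehomogenize_monomial, Finsupp.tail_cons]
  exact f.support_sum_monomial_coeff

theorem dehomogenize_mem {n : ℕ} {I : Ideal (Poly n)} {F : Poly (n + 1)}
    (hF : F ∈ homogenizeIdeal I) : dehomogenize n F ∈ I := by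
  have : homogenizeIdeal I ≤ I.comap (dehomogenize n) := by
    refine Ideal.span_le.2 ?_
    rintro _ ⟨f, hf, rfl⟩
    simpa [dehomogenize_homogenize] using hf
  exact this hF

theorem support_dehomogenize {n : ℕ} (F : Poly (n + 1)) :
    (dehomogenize n F).support = F.support.image Finsupp.tail :=
  support_map_of_single (dehomogenize n).toAddMonoidHom Finsupp.tail (fun _ => 1)
    (fun _ => one_ne_zero) (fun u c => by rw [mul_one]; exact dehomogenize_monomial u c) F

/-- The exponent vector of degree `d` in `n + 1` variables that dehomogenizes to `u`. -/
noncomputable def consDegree {n : ℕ} (d : ℕ) (u : Fin n →₀ ℕ) : Fin (n + 1) →₀ ℕ :=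
  Finsupp.cons (d - u.degree) u

theorem tail_consDegree {n : ℕ} (d : ℕ) (u : Fin n →₀ ℕ) : (consDegree d u).tail = u :=
  Finsupp.tail_cons _ _

theorem consDegree_tail {n d : ℕ} {u : Fin (n + 1) →₀ ℕ} (hu : u.degree = d) :
    consDegree d u.tail = u := by
  subst hu
  conv_rhs => rw [← Finsupp.cons_tail u]
  conv_lhs => rw [← Finsupp.cons_tail u]
  rw [consDegree, degree_cons, Finsupp.tail_cons, Nat.add_sub_cancel]

theorem support_homogenize_mul_subset {n d : ℕ} {f : Poly n} (hf : f.totalDegree ≤ d) :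
    (MvPolynomial.monomial (Finsupp.single 0 (d - f.totalDegree)) 1 * homogenize f).support ⊆
      f.support.image (consDegree d) := by
  rw [homogenize, Finset.mul_sum]
  refine (MvPolynomial.support_sum).trans (Finset.biUnion_subset.2 fun u hu => ?_)
  have hud : u.degree ≤ f.totalDegree := MvPolynomial.le_totalDegree hu
  rw [MvPolynomial.monomial_mul, ← Finsupp.cons_zero_eq_single_zero]
  refine MvPolynomial.support_monomial_subset.trans (Finset.singleton_subset_iff.2 ?_)
  refine Finset.mem_image.2 ⟨u, hu, ?_⟩
  ext i
  refine Fin.cases ?_ (fun i => ?_) i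
  · simp only [consDegree, Finsupp.cons_zero, Finsupp.add_apply]
    omega
  · simp [consDegree]

theorem IsIndependent.indep_image_tail {n d : ℕ} {I : Ideal (Poly n)}
    {B : Finset (Fin (n + 1) →₀ ℕ)} (hB : IsIndependent (homogenizeIdeal I) B)
    (hd : ∀ u ∈ B, u.degree = d) : Indep (supports I) (B.image Finsupp.tail) := by
  rintro _ ⟨f, hf, rfl⟩ hfB
  change MvPolynomial.support f ⊆ _ at hfB
  have hfd : MvPolynomial.totalDegree f ≤ d := by
    refine Finset.sup_le fun u hu => ?_
    obtain ⟨v, hv, rfl⟩ := Finset.mem_image.1 (hfB hu)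
    have := hd v hv
    rw [← Finsupp.cons_tail v, degree_cons] at this
    change Finsupp.degree _ ≤ d
    omega
  have h0 := hB _ ((homogenizeIdeal I).mul_mem_left
    (MvPolynomial.monomial (Finsupp.single 0 (d - MvPolynomial.totalDegree f)) 1)
    (Ideal.subset_span ⟨f, hf, rfl⟩))
    ((support_homogenize_mul_subset hfd).trans (Finset.image_subset_iff.2 fun u hu => ?_))
  · have hf0 := congrArg (dehomogenize n) h0
    rw [map_mul, dehomogenize_homogenize, dehomogenize_monomial, map_zero,
      ← Finsupp.cons_zero_eq_single_zero, Finsupp.tail_cons] at hf0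
    have hone : MvPolynomial.monomial (0 : Fin n →₀ ℕ) (1 : T) = 1 := rfl
    rw [hone, one_mul] at hf0
    rw [hf0]
    rfl
  · obtain ⟨v, hv, rfl⟩ := Finset.mem_image.1 (hfB hu)
    rwa [consDegree_tail (hd v hv)]

theorem Indep.isIndependent_image_consDegree {n : ℕ} {I : Ideal (Poly n)}
    {B : Finset (Fin n →₀ ℕ)} (hB : Indep (supports I) B) (d : ℕ) :
    IsIndependent (homogenizeIdeal I) (B.image (consDegree d)) := by
  intro F hF hFB
  have hs : (dehomogenize n F).support = ∅ := by
    refine hB _ ⟨_, dehomogenize_mem hF, rfl⟩ ?_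
    rw [support_dehomogenize]
    refine Finset.image_subset_iff.2 fun u hu => ?_
    obtain ⟨v, hv, rfl⟩ := Finset.mem_image.1 (hFB hu)
    rwa [tail_consDegree]
  rw [support_dehomogenize, Finset.image_eq_empty] at hs
  exact MvPolynomial.support_eq_empty.1 hs

/-- The Hilbert function of the homogenization of `I` at `d` is the rank of the set of all
monomials of degree at most `d`. -/
theorem hilbertFunction_homogenizeIdeal {n : ℕ} (I : Ideal (Poly n)) (d : ℕ) :
    hilbertFunction (homogenizeIdeal I) d = rank (supports I) (degreeBall n d) := by
  classical
  have hmem : ∀ u : Fin (n + 1) →₀ ℕ,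
      u ∈ (Finset.univ : Finset (Fin (n + 1))).finsuppAntidiag d ↔ u.degree = d := fun u => by
    simp [Finset.mem_finsuppAntidiag, Finsupp.degree_eq_sum]
  refine le_antisymm (Finset.sup_le fun B hB => ?_) (rank_le fun B hBd hB => ?_)
  · rw [Finset.mem_filter, Finset.mem_powerset] at hB
    have hdeg : ∀ u ∈ B, u.degree = d := fun u hu => (hmem u).1 (hB.1 hu)
    have hinj : Set.InjOn Finsupp.tail (B : Set (Fin (n + 1) →₀ ℕ)) := fun u hu v hv huv => by
      rw [← consDegree_tail (hdeg u hu), ← consDegree_tail (hdeg v hv), huv]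
    rw [← Finset.card_image_of_injOn hinj]
    refine (hB.2.indep_image_tail hdeg).card_le_rank (Finset.image_subset_iff.2 fun u hu => ?_)
    have := hdeg u hu
    rw [← Finsupp.cons_tail u, degree_cons] at this
    rw [mem_degreeBall]
    omega
  · have hinj : Function.Injective (consDegree (n := n) d) :=
      Function.LeftInverse.injective (tail_consDegree d)
    rw [← Finset.card_image_of_injective B hinj]
    refine Finset.le_sup (f := Finset.card) (Finset.mem_filter.2 ⟨Finset.mem_powerset.2
      (Finset.image_subset_iff.2 fun u hu => ?_), hB.isIndependent_image_consDegree d⟩)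
    have := mem_degreeBall.1 (hBd hu)
    rw [hmem, consDegree, degree_cons]
    omega

/-! ### Existence of the Hilbert polynomial -/

/-- The leading monomials of the supports with respect to the graded lexicographic order form a
monomial ideal with the same affine Hilbert function. -/
theorem hasDimPoly_of_hasElimination {n : ℕ} {I : Ideal (Poly n)}
    (hI : HasElimination (supports I)) : HasDimPoly I := by
  classical
  set U : Set (Fin n →₀ ℕ) := {u | IsLead (supports I) toDegLex u} with hU
  have hup : IsUpperSet U := by
    rintro u v huv ⟨A, hA, huA, hlt⟩
    obtain ⟨m, rfl⟩ := exists_add_of_le huv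
    refine ⟨_, image_add_mem_supports hA m, Finset.mem_image.2 ⟨u, huA, add_comm _ _⟩,
      fun x hx hxu => ?_⟩
    obtain ⟨y, hy, rfl⟩ := Finset.mem_image.1 hx
    rw [add_comm u m, toDegLex_add, toDegLex_add]
    exact add_lt_add_right (hlt y hy fun h => hxu (by rw [h, add_comm])) _
  obtain ⟨p, hp⟩ := eventuallyPoly_card_degreeBall_filter hup
  refine ⟨p, hp.mono fun d hd => ?_⟩
  rw [← hd, hilbertFunction_homogenizeIdeal,
    rank_eq_card_not_isLead hI toDegLex_injective (fun u hu A hA huA hlt x hx => ?_) (fun u => ?_)]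
  · rw [mem_degreeBall] at hu ⊢
    by_cases hxu : x = u
    · rwa [hxu]
    · exact (Finsupp.DegLex.monotone_degree (hlt x hx hxu).le).trans hu
  · simp [hU]

/-! ### Comparison of dimensions -/

theorem dimHomogeneous_eq {n : ℕ} {J : Ideal (Poly n)} {p : Polynomial ℚ}
    (hp : IsHilbertPolynomial J p) :
    dimHomogeneous J = if p = 0 then -1 else (p.natDegree : ℤ) := by
  have hex : ∃ p, IsHilbertPolynomial J p := ⟨p, hp⟩
  have : hilbertPolynomial J = p := by
    rw [hilbertPolynomial, dif_pos hex]
    exact hex.choose_spec.unique hp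
  rw [dimHomogeneous, this]

/-- The preimage of an independent set under the projection that forgets the last variable is
independent; inside the preimage, `d + 1` monomials of degree at most `2 * d` lie over each monomial
of degree at most `d`. -/
theorem mul_rank_le_rank {n : ℕ} {𝓕 : Set (Finset (Fin (n + 1) →₀ ℕ))} (d : ℕ) :
    (d + 1) * rank (Finset.image dropLast '' 𝓕) (degreeBall n d) ≤
      rank 𝓕 (degreeBall (n + 1) (2 * d)) := by
  classical
  obtain ⟨B, hBd, hB, hcard⟩ :=
    exists_indep_card_eq_rank (Finset.image dropLast '' 𝓕) (degreeBall n d)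
  have hinj : Function.Injective fun x : (Fin n →₀ ℕ) × ℕ => appendLast x.1 x.2 := by
    rintro ⟨v, k⟩ ⟨w, l⟩ h
    have h1 := congrArg dropLast h
    have h2 := DFunLike.congr_fun h (Fin.last n)
    simp only [dropLast_appendLast, appendLast_last] at h1 h2
    rw [h1, h2]
  have := Indep.card_le_rank (𝓕 := 𝓕) (E := degreeBall (n + 1) (2 * d))
    (B := (B ×ˢ Finset.range (d + 1)).image fun x => appendLast x.1 x.2) ?_ ?_
  · rwa [Finset.card_image_of_injective _ hinj, Finset.card_product, Finset.card_range, hcard,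
      mul_comm] at this
  · intro A hA hAB
    refine Finset.image_eq_empty.1 (hB _ ⟨A, hA, rfl⟩ (Finset.image_subset_iff.2 fun u hu => ?_))
    obtain ⟨⟨v, k⟩, hv, rfl⟩ := Finset.mem_image.1 (hAB hu)
    rw [dropLast_appendLast]
    exact (Finset.mem_product.1 hv).1
  · refine Finset.image_subset_iff.2 fun ⟨v, k⟩ hv => ?_
    obtain ⟨hv, hk⟩ := Finset.mem_product.1 hv
    have hvd := mem_degreeBall.1 (hBd hv)
    simp only [Finset.mem_range] at hk
    rw [mem_degreeBall, ← degree_dropLast_add, dropLast_appendLast, appendLast_last]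
    dsimp only at *
    omega

/-- Only supports matter for the dimension: if the supports of `J` are the projections of those of
`I`, then `dim J ≤ dim I - 1`. -/
theorem dimPoly_le_of_supports_eq {n : ℕ} {I : Ideal (Poly (n + 1))} {J : Ideal (Poly n)}
    (hI : HasElimination (supports I)) (hI' : I ≠ ⊤)
    (hJ : supports J = Finset.image dropLast '' supports I) :
    HasDimPoly I ∧ HasDimPoly J ∧ dimPoly J ≤ dimPoly I - 1 := by
  have hdI := hasDimPoly_of_hasElimination hI
  have hdJ : HasDimPoly J :=
    hasDimPoly_of_hasElimination (hJ ▸ hasElimination_image_dropLast hI)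
  refine ⟨hdI, hdJ, ?_⟩
  obtain ⟨p, hp⟩ := hdI
  obtain ⟨q, hq⟩ := hdJ
  rw [dimPoly, dimPoly, dimHomogeneous_eq hp, dimHomogeneous_eq hq]
  -- `{1}` is independent since `I` is proper, so the Hilbert function of `I` does not vanish
  have hp0 : p ≠ 0 := by
    rintro rfl
    obtain ⟨d, hd⟩ := Eventually.exists hp
    rw [hilbertFunction_homogenizeIdeal, Polynomial.eval_zero, Nat.cast_eq_zero] at hd
    have := Indep.card_le_rank (𝓕 := supports I) (B := {0}) (E := degreeBall (n + 1) d) ?_ ?_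
    · simp [hd] at this
    · intro A hA hA0
      refine (Finset.subset_singleton_iff.1 hA0).resolve_right fun h => ?_
      exact singleton_zero_notMem_supports hI' (h ▸ hA)
    · simp
  rw [if_neg hp0]
  split_ifs with hq0
  · have := Int.natCast_nonneg p.natDegree
    omega
  · have := natDegree_lt_of_mul_eval_le (p := p) hq0 ?_ ?_
    · omega
    · filter_upwards [hq] with d hd
      rw [← hd]
      positivity
    · have htwo : Tendsto (fun d : ℕ => 2 * d) atTop atTop :=
        tendsto_id.const_mul_atTop' two_pos
      filter_upwards [hq, htwo.eventually hp] with d hqd hpd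
      have hle := mul_rank_le_rank (𝓕 := supports I) d
      rw [← hJ, ← hilbertFunction_homogenizeIdeal, ← hilbertFunction_homogenizeIdeal] at hle
      rw [← hqd]
      push_cast at hpd
      rw [← hpd]
      exact_mod_cast hle

end TropIdeal

theorem propositionp (n : ℕ) (a : ℝ) :
    (∀ I : Ideal (TropIdeal.Poly (n + 1)), TropIdeal.IsTropicalPoly I → I ≠ ⊤ →
      TropIdeal.HasDimPoly I ∧ TropIdeal.HasDimPoly (TropIdeal.specializePoly a I) ∧
        TropIdeal.dimPoly (TropIdeal.specializePoly a I) ≤ TropIdeal.dimPoly I - 1) ∧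
    (∀ I : Ideal (TropIdeal.Laurent (n + 1)), TropIdeal.IsTropicalLaurent I → I ≠ ⊤ →
      TropIdeal.HasDimLaurent I ∧ TropIdeal.HasDimLaurent (TropIdeal.specializeLaurent a I) ∧
        TropIdeal.dimLaurent (TropIdeal.specializeLaurent a I) ≤ TropIdeal.dimLaurent I - 1) := by
  refine ⟨fun I hI hI' => ?_, fun I hI hI' => ?_⟩
  · exact TropIdeal.dimPoly_le_of_supports_eq (TropIdeal.hasElimination_supports hI) hI'
      (TropIdeal.supports_specializePoly a I)
  · exact TropIdeal.dimPoly_le_of_supports_eq (I := TropIdeal.affinePart I)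
      (TropIdeal.hasElimination_supports_affinePart (TropIdeal.hasElimination_supports hI))
      (Ideal.comap_ne_top _ hI') (TropIdeal.supports_affinePart_specializeLaurent a I)
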